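/- Let $f:\mathbb{R}^n\to\mathbb{R}$, $c:\mathbb{R}^n\to\mathbb{R}^p$, $A\in\mathbb{R}^{q\times n}$, $B\in\mathbb{R}^{q\times m}$, $b\in\mathbb{R}^q$, and consider the problem $$\min_{x,y}\ f(x)\quad\text{s.t. } c(x)=0,\ Ax+By=b .$$ Here $\nabla c(x)^{T}$ denotes the Jacobian matrix of $c$ at $x$, and $\|\cdot\|$ the Euclidean norm. **Algorithm (ADMM).** Given $\rho>0$, $y^0\in\mathbb{R}^m$ and $\lambda^0\in\mathbb{R}^q$ with $B^T\lambda^0=0$, iteration $k=0,1,2,\dots$ finds a local minimum $x^{k+1}$ of the subproblem $$\min_x\ f(x)+(\lambda^k)^T(Ax+By^k-b)+\tfrac{\rho}{2}\|Ax+By^k-b\|^2\quad\text{s.t. } c(x)=0,$$ takes $y^{k+1}\in\arg\min_y\{(\lambda^k)^T(Ax^{k+1}+By-b)+\frac{\rho}{2}\|Ax^{k+1}+By-b\|^2\}$, and sets $q^{k+1}=Ax^{k+1}+By^{k+1}-b$, $\lambda^{k+1}=\lambda^k+\rho q^{k+1}$ and $r^{k+1}=\rho A^TB(y^{k+1}-y^k)$.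 The number of iterations performed may be finite or infinite. **Assumption 1.** $f$ and $c$ are continuously differentiable, and in every iteration $k$ that is performed a KKT point $(x^{k+1},\mu^{k+1})$ of the subproblem is found, i.e. $$\nabla f(x^{k+1})+\nabla c(x^{k+1})\mu^{k+1}+A^T\big(\lambda^k+\rho(Ax^{k+1}+By^k-b)\big)=0,\qquad c(x^{k+1})=0 .$$ **Assumption 2.** $f$ and $c$ are continuously differentiable, and twice continuously differentiable on some neighborhood of $x^*$; $(x^*,y^*,\mu^*,\lambda^*)$ is a KKT point of the problem, i.e. $\nabla f(x^*)+\nabla c(x^*)\mu^*+A^T\lambda^*=0$, $B^T\lambda^*=0$, $c(x^*)=0$, $Ax^*+By^*=b$; the rows of $$C=\begin{bmatrix}\nabla c(x^*)^T&0\\A&B\end{bmatrix}$$ are linearly independent; and, with $H_{xx}(x,\mu)=\nabla^2 f(x)+\sum_j\mu_j\nabla^2c_j(x)$, $$z^T\begin{bmatrix}H_{xx}(x^*,\mu^*)&0\\0&0\end{bmatrix}z>0\quad\text{for all } z\neq0\text{ with } Cz=0 .$$ **Proposition.** Let Assumption 2 hold. There exist constants $\varepsilon>0$ and $\rho^*>0$,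 which depend only on the problem data $(f,c,A,B,b)$ and on $(x^*,y^*,\mu^*,\lambda^*)$, with the following property. For every run of the algorithm satisfying Assumption 1, if $\rho>\rho^*$ and $$\|(x^{k+1},y^{k+1},\mu^{k+1},\lambda^{k+1})-(x^*,y^*,\mu^*,\lambda^*)\|<\varepsilon$$ for some iteration $k\ge0$ that is performed, then $$0\le V^k-V^{k+1}-\rho\|B(y^k-y^{k+1})\|^2-\frac{\rho}{2}\|q^{k+1}\|^2,$$ where $V^k=\frac1\rho\|\lambda^k-\lambda^*\|^2+\rho\|B(y^k-y^*)\|^2$. -/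

import Mathlib

noncomputable section

namespace NonconvexADMM

/-- `ℝⁿ` with the Euclidean norm. -/
abbrev Vec (n : ℕ) := EuclideanSpace ℝ (Fin n)

/-- The matrix-vector product `M v`, as a map between Euclidean spaces. -/
abbrev app {k l : ℕ} (M : Matrix (Fin k) (Fin l) ℝ) (v : Vec l) : Vec k :=
  WithLp.toLp 2 (M.mulVec v.ofLp)

/-- The Jacobian matrix `∇c(x)ᵀ`, with `(i, j)` entry `∂c_i/∂x_j (x)`. -/
def jacobian {n p : ℕ} (c : Vec n → Vec p) (x : Vec n) : Matrix (Fin p) (Fin n) ℝ :=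
  Matrix.of fun i j => (fderiv ℝ c x (EuclideanSpace.single j 1)) i

/-- The Hessian matrix `∇²g(x)`, with `(i, j)` entry `∂²g/∂x_i∂x_j (x)`. -/
def hessian {n : ℕ} (g : Vec n → ℝ) (x : Vec n) : Matrix (Fin n) (Fin n) ℝ :=
  Matrix.of fun i j =>
    fderiv ℝ (fderiv ℝ g) x (EuclideanSpace.single i 1) (EuclideanSpace.single j 1)

/-- The data of the problem `min f(x)` subject to `c(x) = 0`, `A x + B y = b`,
over `(x, y) ∈ ℝⁿ × ℝᵐ`. -/
structure Problem (n m p q : ℕ) where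
  f : Vec n → ℝ
  c : Vec n → Vec p
  A : Matrix (Fin q) (Fin n) ℝ
  B : Matrix (Fin q) (Fin m) ℝ
  b : Vec q

namespace Problem

variable {n m p q : ℕ} (P : Problem n m p q)

/-- The violation `A x + B y - b` of the linear constraint. -/
def linRes (x : Vec n) (y : Vec m) : Vec q :=
  app P.A x + app P.B y - P.b

/-- `(x, y, μ, lam)` is a KKT point of the problem. -/
structure IsKKT (x : Vec n) (y : Vec m) (mu : Vec p) (lam : Vec q) : Prop where
  stationary_x :
    gradient P.f x + app (jacobian P.c x).transpose mu + app P.A.transpose lam = 0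
  stationary_y : app P.B.transpose lam = 0
  feasible_c : P.c x = 0
  feasible_lin : app P.A x + app P.B y = P.b

/-- The objective `f(x) + lamᵀ(A x + B y - b) + (ρ/2)‖A x + B y - b‖²` of the subproblem
in `x`, in which `y` and `lam` are fixed. -/
def subObjective (rho : ℝ) (y : Vec m) (lam : Vec q) (x : Vec n) : ℝ :=
  P.f x + inner ℝ lam (P.linRes x y) + rho / 2 * ‖P.linRes x y‖ ^ 2

/-- `x` is a local minimum of the subproblem: it is feasible, and minimizes the objective
over the feasible points of a neighbourhood. -/
def IsSubLocalMin (rho : ℝ) (y : Vec m) (lam : Vec q) (x : Vec n) : Prop :=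
  P.c x = 0 ∧ IsLocalMinOn (P.subObjective rho y lam) {x' | P.c x' = 0} x

/-- `(x, μ)` is a KKT point of the subproblem. -/
structure IsSubKKT (rho : ℝ) (y : Vec m) (lam : Vec q) (x : Vec n) (mu : Vec p) : Prop where
  stationary :
    gradient P.f x + app (jacobian P.c x).transpose mu
      + app P.A.transpose (lam + rho • P.linRes x y) = 0
  feasible : P.c x = 0

/-- The sequences `x, y, lam, qres, rres` record the first `N` iterations (`N = ⊤`: infinitely
many) of the ADMM with penalty parameter `rho`; iteration `k` produces the entries of index
`k + 1`. The entries of index `0` of `x`, `qres`, `rres` are not used. -/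
structure IsADMMRun (rho : ℝ) (N : ℕ∞) (x : ℕ → Vec n) (y : ℕ → Vec m) (lam : ℕ → Vec q)
    (qres : ℕ → Vec q) (rres : ℕ → Vec n) : Prop where
  rho_pos : 0 < rho
  init : app P.B.transpose (lam 0) = 0
  x_step : ∀ k : ℕ, (k : ℕ∞) < N → P.IsSubLocalMin rho (y k) (lam k) (x (k + 1))
  y_step : ∀ k : ℕ, (k : ℕ∞) < N →
    IsMinOn (fun y' : Vec m => inner ℝ (lam k) (P.linRes (x (k + 1)) y')
      + rho / 2 * ‖P.linRes (x (k + 1)) y'‖ ^ 2) Set.univ (y (k + 1))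
  lam_step : ∀ k : ℕ, (k : ℕ∞) < N →
    lam (k + 1) = lam k + rho • P.linRes (x (k + 1)) (y (k + 1))
  primal_residual : ∀ k : ℕ, (k : ℕ∞) < N → qres (k + 1) = P.linRes (x (k + 1)) (y (k + 1))
  dual_residual : ∀ k : ℕ, (k : ℕ∞) < N →
    rres (k + 1) = rho • app P.A.transpose (app P.B (y (k + 1) - y k))

/-- `f` and `c` are continuously differentiable, and each iteration finds a KKT point
`(x (k + 1), mu (k + 1))` of its subproblem. -/
structure KKTIterates (rho : ℝ) (N : ℕ∞) (x : ℕ → Vec n) (y : ℕ → Vec m) (lam : ℕ → Vec q)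
    (mu : ℕ → Vec p) : Prop where
  contDiff_f : ContDiff ℝ 1 P.f
  contDiff_c : ContDiff ℝ 1 P.c
  kkt : ∀ k : ℕ, (k : ℕ∞) < N → P.IsSubKKT rho (y k) (lam k) (x (k + 1)) (mu (k + 1))

/-- The Jacobian `[∇c(x)ᵀ 0; A B]` of all constraints. -/
def constraintJacobian (x : Vec n) : Matrix (Fin p ⊕ Fin q) (Fin n ⊕ Fin m) ℝ :=
  Matrix.fromBlocks (jacobian P.c x) 0 P.A P.B

/-- `H_xx(x, μ) = ∇²f(x) + ∑ j, μ_j ∇²c_j(x)`. -/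
def Hxx (x : Vec n) (mu : Vec p) : Matrix (Fin n) (Fin n) ℝ :=
  hessian P.f x + ∑ j : Fin p, mu j • hessian (fun x' => P.c x' j) x

/-- `(x, y, mu, lam)` is a KKT point which satisfies the linear independence constraint
qualification and the second-order sufficient conditions. -/
structure OverallRegularity (x : Vec n) (y : Vec m) (mu : Vec p) (lam : Vec q) : Prop where
  contDiff_f : ContDiff ℝ 1 P.f
  contDiff_c : ContDiff ℝ 1 P.c
  kkt : P.IsKKT x y mu lam
  contDiff_two : ∃ U : Set (Vec n), IsOpen U ∧ x ∈ U ∧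
    ContDiffOn ℝ 2 P.f U ∧ ContDiffOn ℝ 2 P.c U
  licq : LinearIndependent ℝ (fun i => P.constraintJacobian x i)
  second_order : ∀ z : Fin n ⊕ Fin m → ℝ, z ≠ 0 →
    (P.constraintJacobian x).mulVec z = 0 →
    0 < dotProduct z ((Matrix.fromBlocks (P.Hxx x mu) 0 0 0).mulVec z)

/-- The Lyapunov function `V = (1/ρ)‖lam - lamS‖² + ρ‖B(y - yS)‖²` at `(y, lam)`. -/
def lyapunov (rho : ℝ) (yS : Vec m) (lamS : Vec q) (y : Vec m) (lam : Vec q) : ℝ :=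
  1 / rho * ‖lam - lamS‖ ^ 2 + rho * ‖app P.B (y - yS)‖ ^ 2

end Problem

/-- The Euclidean norm of the stacked vector `(x, y, mu, lam)`. -/
def stackedNorm {n m p q : ℕ} (x : Vec n) (y : Vec m) (mu : Vec p) (lam : Vec q) : ℝ :=
  Real.sqrt (‖x‖ ^ 2 + ‖y‖ ^ 2 + ‖mu‖ ^ 2 + ‖lam‖ ^ 2)

end NonconvexADMM

end

open Filter Topology

namespace NonconvexADMM

/-! Write d = x^{k+1} - x^*, r = q^{k+1}. Pairing the difference of the two KKT systems with d, and
using that B^T annihilates every multiplier (so r is orthogonal to the range of B), turns the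
claimed quantity into 2G + (ρ/2)‖r‖², where G pairs d with the change of the Lagrangian gradient
(`lyapunov_decrease_eq`). No other ρ-term survives, so ε need not depend on ρ. Near the solution, G
is at least the Hessian form h(d) minus η‖d‖², and ‖∇c(x^*)^T d‖² ≤ η‖d‖² because both points
satisfy c = 0 (`eventually_lagrangian_expansion`). The second-order condition and Finsler's lemma
give δ‖d‖² ≤ h(d) + K(‖∇c(x^*)^T d‖² + ‖r‖²) (`exists_coercive`). A small η and ρ > 4K absorb the
errors. -/

/-- Finsler's lemma: a 2-homogeneous function that is positive on the nontrivial zeros of a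
nonnegative one becomes coercive after adding a large multiple of the latter. -/
theorem exists_coercive_add_mul {E : Type*} [NormedAddCommGroup E] [NormedSpace ℝ E]
    [FiniteDimensional ℝ E] (Q R : E → ℝ) (hQ : Continuous Q) (hR : Continuous R)
    (hQs : ∀ (t : ℝ) z, Q (t • z) = t ^ 2 * Q z) (hRs : ∀ (t : ℝ) z, R (t • z) = t ^ 2 * R z)
    (hR0 : ∀ z, 0 ≤ R z) (hpos : ∀ z, z ≠ 0 → R z = 0 → 0 < Q z) :
    ∃ K > (0 : ℝ), ∃ δ > (0 : ℝ), ∀ z, δ * ‖z‖ ^ 2 ≤ Q z + K * R z := by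
  have hc : IsCompact (Metric.sphere (0 : E) 1) := isCompact_sphere 0 1
  -- The open sets grow with k because R ≥ 0, so by compactness a single one covers the sphere.
  have hcover : ∃ k : ℕ, Metric.sphere (0 : E) 1 ⊆ {z | 0 < Q z + k * R z} := by
    refine hc.elim_directed_cover (fun k : ℕ => {z | 0 < Q z + k * R z}) (fun k => ?_) ?_ ?_
    · exact isOpen_lt continuous_const (by fun_prop)
    · intro z hz
      have hz0 : z ≠ 0 := by
        rintro rfl
        simp at hz
      rw [Set.mem_iUnion]
      by_cases h : R z = 0
      · exact ⟨0, by simpa [h] using hpos z hz0 h⟩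
      · have hRz : 0 < R z := lt_of_le_of_ne (hR0 z) (Ne.symm h)
        obtain ⟨k, hk⟩ := exists_nat_gt (-Q z / R z)
        refine ⟨k, ?_⟩
        rw [div_lt_iff₀ hRz] at hk
        simp only [Set.mem_ofPred_eq]
        linarith
    · refine Monotone.directed_le fun i j hij z hz => ?_
      simp only [Set.mem_ofPred_eq] at hz ⊢
      have : (i : ℝ) * R z ≤ j * R z :=
        mul_le_mul_of_nonneg_right (by exact_mod_cast hij) (hR0 z)
      linarith
  obtain ⟨k, hk⟩ := hcover
  have hmin : ∃ δ > (0 : ℝ), ∀ z ∈ Metric.sphere (0 : E) 1, δ ≤ Q z + k * R z := by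
    rcases (Metric.sphere (0 : E) 1).eq_empty_or_nonempty with h | h
    · exact ⟨1, one_pos, by simp [h]⟩
    · obtain ⟨z, hz, hm⟩ := hc.exists_isMinOn h
        (f := fun z => Q z + k * R z) (by fun_prop)
      exact ⟨_, hk hz, fun w hw => hm hw⟩
  obtain ⟨δ, hδ, hm⟩ := hmin
  -- The cover may give k = 0; k + 1 is positive, and the bound survives since R ≥ 0.
  refine ⟨k + 1, by positivity, δ, hδ, fun z => ?_⟩
  by_cases hz : z = 0
  · have h1 := hQs 0 0
    have h2 := hRs 0 0
    simp only [zero_smul] at h1 h2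
    subst hz
    simp only [norm_zero]
    nlinarith
  · have hn : ‖z‖ ≠ 0 := norm_ne_zero_iff.mpr hz
    have h := hm (‖z‖⁻¹ • z) (by simp [norm_smul, hn])
    rw [hQs, hRs] at h
    have h2 := mul_le_mul_of_nonneg_right h (sq_nonneg ‖z‖)
    have h3 : (‖z‖⁻¹ ^ 2 * Q z + k * (‖z‖⁻¹ ^ 2 * R z)) * ‖z‖ ^ 2 = Q z + k * R z := by
      field_simp
    rw [h3] at h2
    have := hR0 z
    linarith

/-! ### Second-order expansions -/

section Taylor

variable {E F : Type*} [NormedAddCommGroup E] [NormedSpace ℝ E]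
  [NormedAddCommGroup F] [NormedSpace ℝ F]

/-- A function with Lipschitz derivative near `a` agrees with its linearization at a moving
base point `x`, evaluated at `a`, up to a quadratic error. -/
theorem exists_norm_fderiv_apply_sub_le {c : E → F} {a : E} (hc : ContDiffAt ℝ 2 c a) :
    ∃ L > (0 : ℝ), ∀ᶠ x in 𝓝 a,
      ‖fderiv ℝ c x (x - a) - (c x - c a)‖ ≤ L * ‖x - a‖ ^ 2 := by
  have h1 : ContDiffAt ℝ 1 (fderiv ℝ c) a := hc.fderiv_right (by norm_num)
  obtain ⟨K, t, ht, hK⟩ := h1.exists_lipschitzOnWith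
  have hd : ∀ᶠ x in 𝓝 a, DifferentiableAt ℝ c x := by
    filter_upwards [hc.eventually (by simp)] with x hx
    exact hx.differentiableAt (by norm_num)
  obtain ⟨r, hr, hball⟩ := Metric.eventually_nhds_iff_ball.mp (hd.and ht)
  -- Any z in the closed ball has ‖z - x‖ ≤ 2‖x - a‖, hence the 2K; the 1 ensures positivity.
  refine ⟨2 * K + 1, by positivity, ?_⟩
  filter_upwards [Metric.ball_mem_nhds a hr] with x hx
  have hsub : Metric.closedBall a ‖x - a‖ ⊆ Metric.ball a r := fun z hz => by
    rw [Metric.mem_closedBall] at hz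
    rw [Metric.mem_ball, dist_eq_norm] at hx
    exact lt_of_le_of_lt hz hx
  have hmv := (convex_closedBall a ‖x - a‖).norm_image_sub_le_of_norm_fderiv_le'
    (f := c) (φ := fderiv ℝ c x) (C := 2 * K * ‖x - a‖) (x := a) (y := x)
    (fun z hz => (hball z (hsub hz)).1)
    (fun z hz => by
      have := hK.norm_sub_le (hball z (hsub hz)).2 (hball x hx).2
      have hzx : ‖z - x‖ ≤ 2 * ‖x - a‖ := by
        rw [Metric.mem_closedBall, dist_eq_norm] at hz
        have : z - x = (z - a) - (x - a) := by abel
        rw [this]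
        linarith [norm_sub_le (z - a) (x - a)]
      calc _ ≤ (K : ℝ) * ‖z - x‖ := this
        _ ≤ K * (2 * ‖x - a‖) := by gcongr
        _ = _ := by ring)
    (by simp) (by simp [dist_eq_norm])
  rw [norm_sub_rev] at hmv
  nlinarith [sq_nonneg ‖x - a‖]

/-- The first-order expansion of the derivative, evaluated on the increment. -/
theorem eventually_norm_fderiv_sub_apply_le {f : E → F} {a : E} (hf : ContDiffAt ℝ 2 f a)
    {η : ℝ} (hη : 0 < η) :
    ∀ᶠ x in 𝓝 a, ‖fderiv ℝ f x (x - a) - fderiv ℝ f a (x - a)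
      - fderiv ℝ (fderiv ℝ f) a (x - a) (x - a)‖ ≤ η * ‖x - a‖ ^ 2 := by
  have h1 : ContDiffAt ℝ 1 (fderiv ℝ f) a := hf.fderiv_right (by norm_num)
  have h2 := (h1.differentiableAt (by norm_num)).hasFDerivAt.isLittleO
  filter_upwards [h2.def hη] with x hx
  have := (fderiv ℝ f x - fderiv ℝ f a
    - fderiv ℝ (fderiv ℝ f) a (x - a)).le_of_opNorm_le hx (x - a)
  simp only [sub_apply] at this
  linarith

variable {G : Type*} [NormedAddCommGroup G] [InnerProductSpace ℝ G]

/-- Along the level set of `c` through `a`, the pairing of the increment `x - a` with the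
difference of the Lagrangian gradients at `(x, μ)` and `(a, ν)` is bounded below by the Hessian
quadratic form of the Lagrangian, up to `o(‖x - a‖²)`; the increment is nearly tangent. -/
theorem eventually_lagrangian_expansion {f : E → ℝ} {c : E → G} {a : E} (ν : G)
    (hf : ContDiffAt ℝ 2 f a) (hc : ContDiffAt ℝ 2 c a) {η : ℝ} (hη : 0 < η) :
    ∃ ε > (0 : ℝ), ∀ x (μ : G), ‖x - a‖ < ε → ‖μ - ν‖ < ε → c x = c a →
      (fderiv ℝ (fderiv ℝ f) a (x - a) (x - a)
          + inner ℝ ν (fderiv ℝ (fderiv ℝ c) a (x - a) (x - a)) - η * ‖x - a‖ ^ 2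
        ≤ fderiv ℝ f x (x - a) - fderiv ℝ f a (x - a)
          + inner ℝ μ (fderiv ℝ c x (x - a)) - inner ℝ ν (fderiv ℝ c a (x - a))) ∧
      ‖fderiv ℝ c a (x - a)‖ ^ 2 ≤ η * ‖x - a‖ ^ 2 := by
  obtain ⟨L, hL, hLx⟩ := exists_norm_fderiv_apply_sub_le hc
  have hη3 : 0 < η / 3 := by positivity
  have e1 := eventually_norm_fderiv_sub_apply_le hf hη3
  have hην : 0 < η / (3 * (‖ν‖ + 1)) := by positivity
  have e2 := eventually_norm_fderiv_sub_apply_le hc hην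
  have e3 := (hc.differentiableAt (by norm_num)).hasFDerivAt.isLittleO.def (Real.sqrt_pos.mpr hη)
  obtain ⟨r, hr, hball⟩ :=
    Metric.eventually_nhds_iff_ball.mp (hLx.and (e1.and (e2.and e3)))
  -- Three errors share η: the expansion of f', that of c' paired with ν, and the multiplier error.
  -- The last is at most ‖μ - ν‖ · L‖x - a‖², since c x = c a makes c'(x)(x - a) quadratically
  -- small.
  refine ⟨min r (η / (3 * L)), by positivity, fun x μ hx hμ hcx => ?_⟩
  obtain ⟨b0, b1, b2, b3⟩ := hball x
    (by rw [Metric.mem_ball, dist_eq_norm]; exact hx.trans_le (min_le_left _ _))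
  simp only [hcx, sub_self, sub_zero, zero_sub, norm_neg] at b0 b3
  constructor
  · have i1 : |inner ℝ (μ - ν) (fderiv ℝ c x (x - a))| ≤ η / 3 * ‖x - a‖ ^ 2 := by
      have hm : ‖μ - ν‖ ≤ η / (3 * L) := (hμ.trans_le (min_le_right _ _)).le
      calc _ ≤ ‖μ - ν‖ * ‖fderiv ℝ c x (x - a)‖ := abs_real_inner_le_norm _ _
        _ ≤ η / (3 * L) * (L * ‖x - a‖ ^ 2) := by gcongr
        _ = _ := by field_simp
    have i2 : |inner ℝ ν (fderiv ℝ c x (x - a) - fderiv ℝ c a (x - a)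
        - fderiv ℝ (fderiv ℝ c) a (x - a) (x - a))| ≤ η / 3 * ‖x - a‖ ^ 2 := by
      calc _ ≤ ‖ν‖ * _ := abs_real_inner_le_norm _ _
        _ ≤ (‖ν‖ + 1) * (η / (3 * (‖ν‖ + 1)) * ‖x - a‖ ^ 2) := by gcongr; linarith
        _ = _ := by field_simp
    simp only [inner_sub_left, inner_sub_right] at i1 i2
    rw [Real.norm_eq_abs] at b1
    rw [abs_le] at b1 i1 i2
    linarith [b1.1, i1.1, i2.1]
  · calc _ ≤ (√η * ‖x - a‖) ^ 2 := by gcongr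
      _ = _ := by rw [mul_pow, Real.sq_sqrt hη.le]

end Taylor

/-! ### Matrices versus Fréchet derivatives -/

section Matrices

variable {k l n m p q : ℕ}

theorem inner_app_transpose (M : Matrix (Fin k) (Fin l) ℝ) (v : Vec k) (w : Vec l) :
    inner ℝ (app M.transpose v) w = inner ℝ v (app M w) := by
  simp only [EuclideanSpace.inner_eq_star_dotProduct, star_trivial]
  rw [dotProduct_comm, Matrix.mulVec_transpose, ← Matrix.dotProduct_mulVec, dotProduct_comm]

theorem app_add (M : Matrix (Fin k) (Fin l) ℝ) (v w : Vec l) :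
    app M (v + w) = app M v + app M w := by
  ext i; simp [Matrix.mulVec_add]

theorem app_sub (M : Matrix (Fin k) (Fin l) ℝ) (v w : Vec l) :
    app M (v - w) = app M v - app M w := by
  ext i; simp [Matrix.mulVec_sub]

theorem app_smul (M : Matrix (Fin k) (Fin l) ℝ) (t : ℝ) (v : Vec l) :
    app M (t • v) = t • app M v := by
  ext i; simp [Matrix.mulVec_smul]

theorem continuous_app (M : Matrix (Fin k) (Fin l) ℝ) : Continuous (app M) := by
  unfold app
  exact (PiLp.continuous_toLp 2 _).comp
    ((Continuous.matrix_mulVec continuous_const continuous_id).comp (PiLp.continuous_ofLp 2 _))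

theorem sum_smul_single (v : Vec l) : ∑ j, v j • EuclideanSpace.single j (1 : ℝ) = v := by
  ext i
  simp [Pi.single_apply]

theorem app_jacobian (c : Vec n → Vec p) (x d : Vec n) :
    app (jacobian c x) d = fderiv ℝ c x d := by
  conv_rhs => rw [← sum_smul_single d, map_sum]
  ext i
  simp [jacobian, Matrix.mulVec, dotProduct, mul_comm]

theorem dotProduct_hessian_mulVec (g : Vec n → ℝ) (x d : Vec n) :
    dotProduct d.ofLp ((hessian g x).mulVec d.ofLp) = fderiv ℝ (fderiv ℝ g) x d d := by
  have key : ∀ T : Vec n →L[ℝ] Vec n →L[ℝ] ℝ, T d d =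
      ∑ i, d i * ∑ j, T (EuclideanSpace.single i 1) (EuclideanSpace.single j 1) * d j := fun T => by
    have h1 : T d = ∑ i, d i • T (EuclideanSpace.single i 1) := by
      conv_lhs => rw [← sum_smul_single d, map_sum]
      simp only [map_smul]
    have h2 : ∀ S : Vec n →L[ℝ] ℝ, S d = ∑ j, S (EuclideanSpace.single j 1) * d j := fun S => by
      conv_lhs => rw [← sum_smul_single d, map_sum]
      simp only [map_smul, smul_eq_mul, mul_comm]
    rw [h1, sum_apply]
    simp only [smul_apply, smul_eq_mul, h2 (T _)]
  exact (key _).symm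

/-- Links the coordinatewise Hessians in `Hxx` to the second derivative of the vector-valued c used
in the expansions. -/
theorem fderiv_fderiv_coord {c : Vec n → Vec p} {x : Vec n} (hc : ContDiffAt ℝ 2 c x)
    (j : Fin p) (d e : Vec n) :
    fderiv ℝ (fderiv ℝ fun x' => c x' j) x d e = fderiv ℝ (fderiv ℝ c) x d e j := by
  let π : Vec p →L[ℝ] ℝ := EuclideanSpace.proj j
  have h1 : ContDiffAt ℝ 1 (fderiv ℝ c) x := hc.fderiv_right (by norm_num)
  have hev : (fderiv ℝ fun x' => c x' j) =ᶠ[𝓝 x] fun x' => π ∘L fderiv ℝ c x' := by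
    filter_upwards [hc.eventually (by simp)] with z hz
    exact (π.hasFDerivAt.comp z (hz.differentiableAt (by norm_num)).hasFDerivAt).fderiv
  have h2 := (ContinuousLinearMap.compL ℝ (Vec n) (Vec p) ℝ π).hasFDerivAt.comp x
    (h1.differentiableAt (by norm_num)).hasFDerivAt
  rw [hev.fderiv_eq]
  have h3 := h2.fderiv
  change fderiv ℝ (fun x' => π ∘L fderiv ℝ c x') x = _ at h3
  rw [h3]
  rfl

end Matrices

/-! ### Coercivity, optimality in y, and the Lyapunov identity -/

namespace Problem

variable {n m p q : ℕ} (P : Problem n m p q)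

theorem dotProduct_Hxx_mulVec {x : Vec n} (hc : ContDiffAt ℝ 2 P.c x) (mu : Vec p) (d : Vec n) :
    dotProduct d.ofLp ((P.Hxx x mu).mulVec d.ofLp) =
      fderiv ℝ (fderiv ℝ P.f) x d d + inner ℝ mu (fderiv ℝ (fderiv ℝ P.c) x d d) := by
  rw [Hxx, Matrix.add_mulVec, dotProduct_add, dotProduct_hessian_mulVec, Matrix.sum_mulVec,
    dotProduct_sum]
  congr 1
  simp only [Matrix.smul_mulVec, dotProduct_smul, dotProduct_hessian_mulVec,
    fderiv_fderiv_coord hc, PiLp.inner_apply, smul_eq_mul, RCLike.inner_apply, conj_trivial]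
  exact Finset.sum_congr rfl fun j _ => mul_comm _ _

/-- The second-order sufficient condition in penalized form. -/
theorem OverallRegularity.exists_coercive {P : Problem n m p q} {xS : Vec n} {yS : Vec m}
    {muS : Vec p} {lamS : Vec q} (h : P.OverallRegularity xS yS muS lamS)
    (hc : ContDiffAt ℝ 2 P.c xS) :
    ∃ K > (0 : ℝ), ∃ δ > (0 : ℝ), ∀ (d : Vec n) (e : Vec m), δ * ‖d‖ ^ 2 ≤
      fderiv ℝ (fderiv ℝ P.f) xS d d + inner ℝ muS (fderiv ℝ (fderiv ℝ P.c) xS d d)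
        + K * (‖fderiv ℝ P.c xS d‖ ^ 2 + ‖app P.A d + app P.B e‖ ^ 2) := by
  obtain ⟨K, hK, δ, hδ, hz⟩ := exists_coercive_add_mul (E := Vec n × Vec m)
    (fun z => fderiv ℝ (fderiv ℝ P.f) xS z.1 z.1
      + inner ℝ muS (fderiv ℝ (fderiv ℝ P.c) xS z.1 z.1))
    (fun z => ‖fderiv ℝ P.c xS z.1‖ ^ 2 + ‖app P.A z.1 + app P.B z.2‖ ^ 2)
    (by fun_prop)
    (by
      have h1 := (continuous_app P.A).comp (continuous_fst (X := Vec n) (Y := Vec m))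
      have h2 := (continuous_app P.B).comp (continuous_snd (X := Vec n) (Y := Vec m))
      exact (by fun_prop : Continuous fun z : Vec n × Vec m =>
        ‖fderiv ℝ P.c xS z.1‖ ^ 2).add ((h1.add h2).norm.pow 2))
    (fun t z => by
      simp only [Prod.smul_fst, map_smul, smul_apply, inner_smul_right,
        smul_eq_mul]
      ring)
    (fun t z => by
      simp only [Prod.smul_fst, Prod.smul_snd, map_smul, app_smul, ← smul_add, norm_smul, mul_pow,
        Real.norm_eq_abs, sq_abs]
      ring)
    (fun z => by positivity)
    (fun z hz0 hR => by
      have hJ : fderiv ℝ P.c xS z.1 = 0 := by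
        rw [← norm_eq_zero, ← sq_eq_zero_iff]
        linarith [sq_nonneg ‖fderiv ℝ P.c xS z.1‖, sq_nonneg ‖app P.A z.1 + app P.B z.2‖]
      have hL : app P.A z.1 + app P.B z.2 = 0 := by
        rw [← norm_eq_zero, ← sq_eq_zero_iff]
        linarith [sq_nonneg ‖fderiv ℝ P.c xS z.1‖, sq_nonneg ‖app P.A z.1 + app P.B z.2‖]
      have hs := h.second_order (Sum.elim z.1.ofLp z.2.ofLp)
        (fun h0 => hz0 (by
          refine Prod.ext ?_ ?_
          · ext i; simpa using congrFun h0 (Sum.inl i)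
          · ext i; simpa using congrFun h0 (Sum.inr i)))
        (by
          rw [constraintJacobian, Matrix.fromBlocks_mulVec]
          ext (i | i)
          · rw [← app_jacobian] at hJ
            simpa using congrArg (fun v : Vec p => v i) hJ
          · simpa using congrArg (fun v : Vec q => v i) hL)
      rw [Matrix.fromBlocks_mulVec, ← dotProduct_Hxx_mulVec P hc] at *
      simpa [dotProduct, Fintype.sum_sum_type] using hs)
  refine ⟨K, hK, δ, hδ, fun d e => le_trans ?_ (hz (d, e))⟩
  -- Only control of d is needed, so the e-part of the bound is dropped.
  have : ‖d‖ ≤ ‖(d, e)‖ := norm_fst_le (d, e)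
  gcongr

/-- The multiplier update turns optimality of `y` into `Bᵀ lam = 0`. -/
theorem app_transpose_eq_zero_of_isMinOn {rho : ℝ} {x : Vec n} {y : Vec m} {lam : Vec q}
    (h : IsMinOn (fun y' : Vec m => inner ℝ lam (P.linRes x y')
      + rho / 2 * ‖P.linRes x y'‖ ^ 2) Set.univ y) :
    app P.B.transpose (lam + rho • P.linRes x y) = 0 := by
  rw [← inner_self_eq_zero (𝕜 := ℝ), inner_app_transpose]
  set w := app P.B.transpose (lam + rho • P.linRes x y)
  set g := inner ℝ (lam + rho • P.linRes x y) (app P.B w)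
  have hlin : ∀ t : ℝ, P.linRes x (y + t • w) = P.linRes x y + t • app P.B w := fun t => by
    simp only [linRes, app_add, app_smul]; abel
  have hq : ∀ t : ℝ, 0 ≤ t * g + t ^ 2 * (rho / 2 * ‖app P.B w‖ ^ 2) := fun t => by
    have := h (Set.mem_univ (y + t • w))
    simp only [Set.mem_ofPred_eq, hlin, norm_add_sq_real, inner_add_right, inner_smul_right,
      norm_smul, mul_pow, Real.norm_eq_abs, sq_abs] at this
    simp only [g, inner_add_left, inner_smul_left, conj_trivial]
    linarith
  set C := rho / 2 * ‖app P.B w‖ ^ 2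
  -- Here g = ‖w‖². The sign of C is unknown, so the step uses |C| + 1; the first-order term then
  -- dominates and forces g = 0.
  have h1 := hq (-g / (|C| + 1))
  have hC : 0 < |C| + 1 := by positivity
  have h2 : (-g / (|C| + 1)) * g + (-g / (|C| + 1)) ^ 2 * C
      = -(g ^ 2 * (|C| + 1 - C)) / (|C| + 1) ^ 2 := by field_simp; ring
  rw [h2, div_nonneg_iff] at h1
  have h3 : 1 ≤ |C| + 1 - C := by linarith [le_abs_self C]
  have h4 : 0 < (|C| + 1) ^ 2 := by positivity
  rcases h1 with h1 | h1
  · exact pow_eq_zero_iff two_ne_zero |>.mp (by nlinarith [sq_nonneg g])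
  · linarith [h1.2]

/-- Iteration k produces `lam (k + 1)`, so the range is k ≤ N rather than k < N; index 0 is the
initialization. -/
theorem IsADMMRun.app_transpose_lam {P : Problem n m p q} {rho : ℝ} {N : ℕ∞} {x : ℕ → Vec n}
    {y : ℕ → Vec m} {lam : ℕ → Vec q} {qres : ℕ → Vec q} {rres : ℕ → Vec n}
    (h : P.IsADMMRun rho N x y lam qres rres) :
    ∀ k : ℕ, (k : ℕ∞) ≤ N → app P.B.transpose (lam k) = 0
  | 0, _ => h.init
  | k + 1, hk => by
    have hk' : (k : ℕ∞) < N := lt_of_lt_of_le (by exact_mod_cast k.lt_succ_self) hk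
    rw [h.lam_step k hk']
    exact P.app_transpose_eq_zero_of_isMinOn (h.y_step k hk')

theorem inner_gradient (f : Vec n → ℝ) (x d : Vec n) :
    inner ℝ (gradient f x) d = fderiv ℝ f x d := by
  simp [gradient]

/-- The exact decrease of the Lyapunov function in one iteration. -/
theorem lyapunov_decrease_eq {P : Problem n m p q} {rho : ℝ} (hrho : 0 < rho)
    {xS x₁ : Vec n} {yS y₀ y₁ : Vec m} {muS mu₁ : Vec p} {lamS lam₀ lam₁ : Vec q}
    (hS : P.IsKKT xS yS muS lamS) (hsub : P.IsSubKKT rho y₀ lam₀ x₁ mu₁)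
    (hlam : lam₁ = lam₀ + rho • P.linRes x₁ y₁)
    (h0 : app P.B.transpose lam₀ = 0) (h1 : app P.B.transpose lam₁ = 0) :
    P.lyapunov rho yS lamS y₀ lam₀ - P.lyapunov rho yS lamS y₁ lam₁
        - rho * ‖app P.B (y₀ - y₁)‖ ^ 2 - rho / 2 * ‖P.linRes x₁ y₁‖ ^ 2 =
      2 * (fderiv ℝ P.f x₁ (x₁ - xS) - fderiv ℝ P.f xS (x₁ - xS)
          + inner ℝ mu₁ (fderiv ℝ P.c x₁ (x₁ - xS))
          - inner ℝ muS (fderiv ℝ P.c xS (x₁ - xS)))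
        + rho / 2 * ‖P.linRes x₁ y₁‖ ^ 2 := by
  set d := x₁ - xS with hd
  set r := P.linRes x₁ y₁ with hr
  set w := app P.B (y₀ - y₁) with hw
  have hrB : r = app P.A d + app P.B (y₁ - yS) := by
    rw [hr, linRes, ← hS.feasible_lin, hd, app_sub, app_sub]; abel
  have orth : ∀ v, app P.B.transpose v = 0 → ∀ u, inner ℝ v (app P.B u) = 0 := fun v hv u => by
    rw [← inner_app_transpose, hv, inner_zero_left]
  -- ρ r is the difference of two multipliers annihilated by B^T.
  have hrw : ∀ u, inner ℝ r (app P.B u) = 0 := fun u => by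
    have e0 := orth _ h0 u
    have e1 := orth _ h1 u
    rw [hlam, inner_add_left, e0, zero_add, real_inner_smul_left] at e1
    exact (mul_eq_zero.mp e1).resolve_left hrho.ne'
  -- The subproblem uses the old y, so its multiplier differs from `lam₁` by ρ w.
  have hmid : lam₀ + rho • P.linRes x₁ y₀ = lam₁ + rho • w := by
    have : P.linRes x₁ y₀ = r + w := by
      rw [hr, hw, linRes, linRes, app_sub]; abel
    rw [this, hlam, smul_add]; abel
  have s1 := congrArg (fun v => inner ℝ v d) hsub.stationary
  have s2 := congrArg (fun v => inner ℝ v d) hS.stationary_x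
  simp only [hmid, inner_add_left, inner_app_transpose, inner_gradient, app_jacobian,
    inner_zero_left, real_inner_smul_left] at s1 s2
  have hAd : app P.A d = r - app P.B (y₁ - yS) := by rw [hrB]; abel
  have hl1 := orth _ h1 (y₁ - yS)
  have hlS := orth _ hS.stationary_y (y₁ - yS)
  have hrw' : inner ℝ w r = 0 := by rw [real_inner_comm]; exact hrw _
  simp only [hAd, inner_sub_right, hl1, hlS, hrw'] at s1 s2
  have v0 : lam₀ - lamS = (lam₁ - lamS) - rho • r := by rw [hlam]; abel
  have v1 : app P.B (y₀ - yS) = app P.B (y₁ - yS) + w := by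
    rw [hw, ← app_add]; congr 1; abel
  simp only [lyapunov, v0, v1]
  rw [norm_sub_sq_real, norm_add_sq_real, norm_smul, real_inner_smul_right, mul_pow,
    Real.norm_eq_abs, sq_abs, inner_sub_left, real_inner_comm w]
  have : ∀ a b : ℝ, 1 / rho * (a - 2 * (rho * b) + rho ^ 2 * ‖r‖ ^ 2) =
    1 / rho * a - 2 * b + rho * ‖r‖ ^ 2 := fun a b => by field_simp
  rw [this]
  linarith

end Problem

theorem norm_le_stackedNorm_fst {n m p q : ℕ} (x : Vec n) (y : Vec m) (mu : Vec p)
    (lam : Vec q) : ‖x‖ ≤ stackedNorm x y mu lam :=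
  Real.le_sqrt_of_sq_le (by nlinarith [sq_nonneg ‖y‖, sq_nonneg ‖mu‖, sq_nonneg ‖lam‖])

theorem norm_le_stackedNorm_third {n m p q : ℕ} (x : Vec n) (y : Vec m) (mu : Vec p)
    (lam : Vec q) : ‖mu‖ ≤ stackedNorm x y mu lam :=
  Real.le_sqrt_of_sq_le (by nlinarith [sq_nonneg ‖y‖, sq_nonneg ‖x‖, sq_nonneg ‖lam‖])

end NonconvexADMM


theorem mainTheorem2 {n m p q : ℕ} (P : NonconvexADMM.Problem n m p q)
    (xS : NonconvexADMM.Vec n) (yS : NonconvexADMM.Vec m)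
    (muS : NonconvexADMM.Vec p) (lamS : NonconvexADMM.Vec q)
    (hreg : P.OverallRegularity xS yS muS lamS) :
    ∃ ε > (0 : ℝ), ∃ rhoS > (0 : ℝ),
      ∀ (rho : ℝ) (N : ℕ∞)
        (x : ℕ → NonconvexADMM.Vec n) (y : ℕ → NonconvexADMM.Vec m)
        (mu : ℕ → NonconvexADMM.Vec p) (lam : ℕ → NonconvexADMM.Vec q)
        (qres : ℕ → NonconvexADMM.Vec q) (rres : ℕ → NonconvexADMM.Vec n),
        P.IsADMMRun rho N x y lam qres rres →
        P.KKTIterates rho N x y lam mu →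
        rho > rhoS →
        ∀ k : ℕ, (k : ℕ∞) < N →
          NonconvexADMM.stackedNorm (x (k + 1) - xS) (y (k + 1) - yS)
            (mu (k + 1) - muS) (lam (k + 1) - lamS) < ε →
          0 ≤ P.lyapunov rho yS lamS (y k) (lam k)
              - P.lyapunov rho yS lamS (y (k + 1)) (lam (k + 1))
              - rho * ‖NonconvexADMM.app P.B (y k - y (k + 1))‖ ^ 2
              - rho / 2 * ‖qres (k + 1)‖ ^ 2 := by
  obtain ⟨U, hU, hxU, hfU, hcU⟩ := hreg.contDiff_two
  have hf := hfU.contDiffAt (hU.mem_nhds hxU)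
  have hc := hcU.contDiffAt (hU.mem_nhds hxU)
  obtain ⟨K, hK, δ, hδ, hco⟩ := hreg.exists_coercive hc
  obtain ⟨ε, hε, hexp⟩ := NonconvexADMM.eventually_lagrangian_expansion muS hf hc
    (η := δ / (1 + K)) (by positivity)
  -- The lower bound is 2(δ - (1 + K)η)‖d‖² + (ρ/2 - 2K)‖r‖²: the choice of η cancels the first
  -- term, and ρ > 4K makes the second nonnegative.
  refine ⟨ε, hε, 4 * K, by positivity, ?_⟩
  intro rho N x y mu lam qres rres hrun hkkt hrho k hk hnear
  have hsub := hkkt.kkt k hk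
  have hk1 : ((k + 1 : ℕ) : ℕ∞) ≤ N := by
    exact_mod_cast Order.add_one_le_of_lt hk
  rw [hrun.primal_residual k hk, NonconvexADMM.Problem.lyapunov_decrease_eq hrun.rho_pos hreg.kkt
    hsub (hrun.lam_step k hk) (hrun.app_transpose_lam k hk.le) (hrun.app_transpose_lam _ hk1)]
  obtain ⟨h1, h2⟩ := hexp (x (k + 1)) (mu (k + 1))
    ((NonconvexADMM.norm_le_stackedNorm_fst _ _ _ _).trans_lt hnear)
    ((NonconvexADMM.norm_le_stackedNorm_third _ _ _ _).trans_lt hnear)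
    (hsub.feasible.trans hreg.kkt.feasible_c.symm)
  have h3 := hco (x (k + 1) - xS) (y (k + 1) - yS)
  have hlin : NonconvexADMM.app P.A (x (k + 1) - xS) + NonconvexADMM.app P.B (y (k + 1) - yS)
      = P.linRes (x (k + 1)) (y (k + 1)) := by
    rw [NonconvexADMM.Problem.linRes, ← hreg.kkt.feasible_lin, NonconvexADMM.app_sub,
      NonconvexADMM.app_sub]
    abel
  rw [hlin] at h3
  have h4 := mul_le_mul_of_nonneg_left h2 hK.le
  have h5 : δ / (1 + K) * ‖x (k + 1) - xS‖ ^ 2 + K * (δ / (1 + K) * ‖x (k + 1) - xS‖ ^ 2)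
      = δ * ‖x (k + 1) - xS‖ ^ 2 := by field_simp
  have h6 := mul_le_mul_of_nonneg_right hrho.le
    (sq_nonneg ‖P.linRes (x (k + 1)) (y (k + 1))‖)
  linarith
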